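/- Fix $n\ge 1$, $\sigma>0$ and an unbounded convex set $K\subseteq\mathbb{R}^n$ (not necessarily closed). One observes $Y=(Y_1,\dots,Y_n)$ with $Y_i=\mu_i+\xi_i$, where $\xi_1,\dots,\xi_n$ are i.i.d. $N(0,\sigma^2)$, $\sigma^2$ is known and $\mu\in K$ is unknown. The minimax risk over $K$ is $$R(K,\sigma)=\inf_{\hat\nu}\ \sup_{\mu\in K}\ \mathbb{E}\,\|\hat\nu(Y)-\mu\|^2 ,$$ where $\|\cdot\|$ is the Euclidean norm and the infimum is over all measurable maps $\hat\nu:\mathbb{R}^n\to\mathbb{R}^n$. For $c>0$ and $\varepsilon>0$ let $$M^{\mathrm{loc}}(\varepsilon)=\sup_{\theta\in K} M\big(\varepsilon/c,\ B(\theta,\varepsilon)\cap K\big),$$ where $B(\theta,\varepsilon)$ is the closed Euclidean ball and $M(\delta,S)$ is the largest cardinality of a subset of $S$ whose distinct points are at pairwise distance $>\delta$. Set $$\varepsilon^*=\sup\Big\{\varepsilon>0:\ \frac{\varepsilon^2}{\sigma^2}\le \log M^{\mathrm{loc}}(\varepsilon)\Big\}.$$ There is an absolute constant $c_0>0$ such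 that for every $c\ge c_0$ there are constants $A,B>0$, depending only on $c$, such that for all $n$, all $\sigma>0$ and all unbounded convex $K\subseteq\mathbb{R}^n$, $$A\,\varepsilon^{*2}\ \le\ R(K,\sigma)\ \le\ B\,\varepsilon^{*2}.$$ -/

import Mathlib

open scoped NNReal ENNReal

noncomputable section

namespace GaussianSequence

/-- The law of the observation `Y = (Y₁, …, Yₙ)`, `Yᵢ = μᵢ + ξᵢ`, where the `ξᵢ` are independent
`N(0, σ²)` random variables, as a measure on Euclidean `n`-space. -/
def law {n : ℕ} (σ : ℝ≥0) (μ : EuclideanSpace ℝ (Fin n)) :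
    MeasureTheory.Measure (EuclideanSpace ℝ (Fin n)) :=
  (MeasureTheory.Measure.pi fun i => ProbabilityTheory.gaussianReal (μ i) (σ ^ 2)).map
    (WithLp.toLp 2)

/-- The risk `𝔼_μ ‖ν̂(Y) - μ‖²` of the estimator `ν̂` at the parameter `μ`. -/
def risk {n : ℕ} (σ : ℝ≥0) (νhat : EuclideanSpace ℝ (Fin n) → EuclideanSpace ℝ (Fin n))
    (μ : EuclideanSpace ℝ (Fin n)) : ℝ≥0∞ :=
  ∫⁻ y, ‖νhat y - μ‖ₑ ^ 2 ∂(law σ μ)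

/-- The minimax risk over `K`: the infimum over all measurable estimators `ν̂` of the supremum over
`μ ∈ K` of the risk. -/
def minimaxRisk {n : ℕ} (σ : ℝ≥0) (K : Set (EuclideanSpace ℝ (Fin n))) : ℝ≥0∞ :=
  ⨅ (νhat : EuclideanSpace ℝ (Fin n) → EuclideanSpace ℝ (Fin n)) (_ : Measurable νhat),
    ⨆ μ ∈ K, risk σ νhat μ

/-- `M^loc(ε)`: the supremum over `θ ∈ K` of the largest cardinality of an `ε / c`-packing
(pairwise distances `> ε / c`) of `B(θ, ε) ∩ K`, with `B(θ, ε)` the closed ball. -/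
def localPacking {n : ℕ} (c : ℝ≥0) (K : Set (EuclideanSpace ℝ (Fin n))) (ε : ℝ≥0) : ℕ∞ :=
  ⨆ θ ∈ K, Metric.packingNumber (ε / c) (Metric.closedBall θ ε ∩ K)

/-- The local entropy `log M^loc(ε)`, in the extended reals. -/
def localEntropy {n : ℕ} (c : ℝ≥0) (K : Set (EuclideanSpace ℝ (Fin n))) (ε : ℝ≥0) : EReal :=
  ENNReal.log (localPacking c K ε : ℝ≥0∞)

/-- `ε* = sup {ε : ε² / σ² ≤ log M^loc(ε)}`, the supremum being taken in `[0, ∞]`. -/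
def epsStar {n : ℕ} (c σ : ℝ≥0) (K : Set (EuclideanSpace ℝ (Fin n))) : ℝ≥0∞ :=
  ⨆ (ε : ℝ≥0) (_ : (((ε : ℝ) ^ 2 / (σ : ℝ) ^ 2 : ℝ) : EReal) ≤ localEntropy c K ε), (ε : ℝ≥0∞)

end GaussianSequence

end

namespace GaussianSequence

open MeasureTheory ProbabilityTheory
open scoped RealInnerProductSpace

/-! ### Gaussian shifts: exponential moments and likelihood ratios. -/

section Gaussian

/-! Both bounds use that local packing numbers of a convex set decrease with the radius
(`localPacking_anti`). Unboundedness enters through `le_localPacking`: segments of every length give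
local packings of at least 65 points at each scale, which supplies enough hypotheses for testing and
forces `σ ≤ ε*` (`le_epsStar`).

Lower bound: at an admissible `ε`, shrinking the radius to `ε / 2` keeps the packing number but
divides the squared distances by 4, so the packing points are too many to be told apart.
`exists_le_risk` shows this by a second moment bound on the likelihood ratio, in place of Fano's
inequality.

Upper bound: the estimator is the nearest point of a maximal `δ`-separated subset of `K`, with `c *
δ = 2 ε*`. The defining inequality fails at `c * δ`, so a local packing there has at most `M ≤
exp((cδ)² / σ²)` points, and iterated covering leaves at most `M ^ (k + 1)` net points within `c ^
(k + 1) * δ` of a point of `K`. A net point at distance `D` is selected with probability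
exponentially small in `D² / σ²`; as `D²` grows by `c²` per shell while the log-count grows
linearly, the sum over shells is `O(σ²)`, hence `O(ε*²)`. -/

lemma lintegral_pi_prod {ι : Type*} [Fintype ι] (P : ι → Measure ℝ)
    [∀ i, IsProbabilityMeasure (P i)] (f : ι → ℝ → ℝ≥0∞) (hf : ∀ i, Measurable (f i)) :
    ∫⁻ x, ∏ i, f i (x i) ∂(Measure.pi P) = ∏ i, ∫⁻ t, f i t ∂(P i) := by
  have h := lintegral_prod_eq_prod_lintegral_of_indepFun Finset.univ
    (fun i (x : ι → ℝ) => f i (x i))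
    (iIndepFun_pi (μ := P) (X := f) fun i => (hf i).aemeasurable)
    (fun i => (hf i).comp (measurable_pi_apply i))
  rw [h]
  refine Finset.prod_congr rfl fun i _ => ?_
  exact (measurePreserving_eval P i).lintegral_comp (hf i)

lemma lintegral_exp_gaussianReal (m : ℝ) (v : ℝ≥0) (a : ℝ) :
    ∫⁻ y, ENNReal.ofReal (Real.exp ((y - m) * a)) ∂(gaussianReal m v)
      = ENNReal.ofReal (Real.exp (v * a ^ 2 / 2)) := by
  have hint : Integrable (fun y : ℝ => Real.exp ((y - m) * a)) (gaussianReal m v) := by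
    have := (integrable_exp_mul_gaussianReal (μ := m) (v := v) a).const_mul (Real.exp (-m * a))
    refine this.congr (Filter.Eventually.of_forall fun y => ?_)
    simp only [← Real.exp_add]
    congr 1; ring
  rw [← ofReal_integral_eq_lintegral_ofReal hint
    (Filter.Eventually.of_forall fun y => (Real.exp_pos _).le)]
  congr 1
  have h := congrFun (mgf_fun_id_gaussianReal (μ := m) (v := v)) a
  simp only [mgf] at h
  have h2 : (fun y : ℝ => Real.exp ((y - m) * a))
      = fun y => Real.exp (-m * a) * Real.exp (a * y) := by
    funext y
    rw [← Real.exp_add]; congr 1; ring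
  rw [h2, integral_const_mul, h, ← Real.exp_add]
  congr 1; ring

lemma gaussianReal_eq_withDensity (m m' : ℝ) {v : ℝ≥0} (hv : v ≠ 0) :
    gaussianReal m' v = (gaussianReal m v).withDensity fun y =>
      ENNReal.ofReal (Real.exp ((y - m) * ((m' - m) / v) - (m' - m) ^ 2 / (2 * v))) := by
  rw [gaussianReal_of_var_ne_zero m' hv, gaussianReal_of_var_ne_zero m hv,
    ← withDensity_mul _ (measurable_gaussianPDF m v) (by fun_prop)]
  congr 1
  funext y
  have hv' : (v : ℝ) ≠ 0 := by exact_mod_cast hv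
  simp only [Pi.mul_apply, gaussianPDF]
  rw [← ENNReal.ofReal_mul (gaussianPDFReal_nonneg m v y)]
  simp only [gaussianPDFReal]
  rw [mul_assoc _ (Real.exp _), ← Real.exp_add]
  congr 3
  field_simp
  ring

variable {n : ℕ}

instance (σ : ℝ≥0) (μ : EuclideanSpace ℝ (Fin n)) : IsProbabilityMeasure (law σ μ) :=
  Measure.isProbabilityMeasure_map (WithLp.measurable_toLp 2 _).aemeasurable

lemma lintegral_law (σ : ℝ≥0) (μ : EuclideanSpace ℝ (Fin n))
    {f : EuclideanSpace ℝ (Fin n) → ℝ≥0∞} (hf : Measurable f) :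
    ∫⁻ y, f y ∂(law σ μ) = ∫⁻ x, f (WithLp.toLp 2 x)
      ∂(Measure.pi fun i => gaussianReal (μ i) (σ ^ 2)) :=
  lintegral_map hf (WithLp.measurable_toLp 2 _)

/-- Exponential moments of the Gaussian shift. -/
lemma lintegral_exp_inner_law (σ : ℝ≥0) (μ a : EuclideanSpace ℝ (Fin n)) :
    ∫⁻ y, ENNReal.ofReal (Real.exp ⟪y - μ, a⟫) ∂(law σ μ)
      = ENNReal.ofReal (Real.exp (σ ^ 2 * ‖a‖ ^ 2 / 2)) := by
  rw [lintegral_law σ μ (by fun_prop)]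
  have h : ∀ x : Fin n → ℝ, ENNReal.ofReal (Real.exp ⟪WithLp.toLp 2 x - μ, a⟫)
      = ∏ i, ENNReal.ofReal (Real.exp ((x i - μ i) * a i)) := by
    intro x
    rw [← ENNReal.ofReal_prod_of_nonneg (fun i _ => (Real.exp_pos _).le), ← Real.exp_sum]
    congr 2
    simp [PiLp.inner_apply, mul_comm]
  simp_rw [h]
  rw [lintegral_pi_prod _ (fun i y => ENNReal.ofReal (Real.exp ((y - μ i) * a i)))
    (fun i => by fun_prop)]
  simp_rw [lintegral_exp_gaussianReal]
  rw [← ENNReal.ofReal_prod_of_nonneg (fun i _ => (Real.exp_pos _).le), ← Real.exp_sum]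
  congr 2
  rw [EuclideanSpace.norm_sq_eq, Finset.mul_sum, Finset.sum_div]
  simp

/-- The likelihood ratio of the law with mean `μ'` with respect to the law with mean `μ`. -/
noncomputable def likelihoodRatio (σ : ℝ≥0) (μ μ' y : EuclideanSpace ℝ (Fin n)) : ℝ :=
  Real.exp (⟪y - μ, ((σ : ℝ) ^ 2)⁻¹ • (μ' - μ)⟫ - ‖μ' - μ‖ ^ 2 / (2 * σ ^ 2))

lemma measurable_likelihoodRatio (σ : ℝ≥0) (μ μ' : EuclideanSpace ℝ (Fin n)) :
    Measurable (likelihoodRatio σ μ μ') := by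
  unfold likelihoodRatio
  fun_prop

/-- The density factorises over coordinates, so agreement on boxes, where integrals of products
split, is enough. -/
lemma law_eq_withDensity {σ : ℝ≥0} (hσ : σ ≠ 0) (μ μ' : EuclideanSpace ℝ (Fin n)) :
    law σ μ' = (law σ μ).withDensity fun y => ENNReal.ofReal (likelihoodRatio σ μ μ' y) := by
  have hv : σ ^ 2 ≠ 0 := pow_ne_zero 2 hσ
  set g : Fin n → ℝ → ℝ≥0∞ := fun i y => ENNReal.ofReal
    (Real.exp ((y - μ i) * ((μ' i - μ i) / (σ ^ 2 : ℝ≥0)) - (μ' i - μ i) ^ 2 / (2 * (σ ^ 2 : ℝ≥0))))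
    with hg
  have hgm : ∀ i, Measurable (g i) := fun i => by simp only [hg]; fun_prop
  have hpi : Measure.pi (fun i => gaussianReal (μ' i) (σ ^ 2))
      = (Measure.pi fun i => gaussianReal (μ i) (σ ^ 2)).withDensity
        fun x => ∏ i, g i (x i) := by
    refine Measure.pi_eq fun s hs => ?_
    rw [withDensity_apply _ (MeasurableSet.univ_pi hs),
      ← lintegral_indicator (MeasurableSet.univ_pi hs)]
    have : ∀ x : Fin n → ℝ, (Set.univ.pi s).indicator (fun x => ∏ i, g i (x i)) x
        = ∏ i, (s i).indicator (g i) (x i) := by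
      intro x
      by_cases hx : x ∈ Set.univ.pi s
      · rw [Set.indicator_of_mem hx]
        exact Finset.prod_congr rfl fun i _ => (Set.indicator_of_mem (hx i trivial) _).symm
      · rw [Set.indicator_of_notMem hx]
        simp only [Set.mem_univ_pi, not_forall] at hx
        obtain ⟨i, hi⟩ := hx
        exact (Finset.prod_eq_zero (Finset.mem_univ i) (Set.indicator_of_notMem hi _)).symm
    simp_rw [this]
    rw [lintegral_pi_prod _ (fun i => (s i).indicator (g i)) fun i => (hgm i).indicator (hs i)]
    refine Finset.prod_congr rfl fun i _ => ?_
    rw [lintegral_indicator (hs i), gaussianReal_eq_withDensity (μ i) (μ' i) hv,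
      withDensity_apply _ (hs i)]
  have hL : ∀ x : Fin n → ℝ, ENNReal.ofReal (likelihoodRatio σ μ μ' (WithLp.toLp 2 x))
      = ∏ i, g i (x i) := by
    intro x
    rw [← ENNReal.ofReal_prod_of_nonneg (fun i _ => (Real.exp_pos _).le), ← Real.exp_sum,
      likelihoodRatio, Finset.sum_sub_distrib, EuclideanSpace.norm_sq_eq, ← Finset.sum_div]
    congr 3
    · rw [inner_smul_right, PiLp.inner_apply, Finset.mul_sum]
      refine Finset.sum_congr rfl fun i _ => ?_
      simp
      ring
    · simp
  ext s hs
  rw [withDensity_apply _ hs, ← lintegral_indicator hs,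
    lintegral_law _ _ ((measurable_likelihoodRatio σ μ μ').ennreal_ofReal.indicator hs),
    law, Measure.map_apply (WithLp.measurable_toLp 2 _) hs, hpi,
    withDensity_apply _ (WithLp.measurable_toLp 2 _ hs),
    ← lintegral_indicator (WithLp.measurable_toLp 2 _ hs)]
  refine lintegral_congr fun x => ?_
  by_cases hx : WithLp.toLp 2 x ∈ s
  · rw [Set.indicator_of_mem hx, Set.indicator_of_mem (show x ∈ WithLp.toLp 2 ⁻¹' s from hx), hL]
  · rw [Set.indicator_of_notMem hx,
      Set.indicator_of_notMem (show x ∉ WithLp.toLp 2 ⁻¹' s from hx)]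

/-- Squaring doubles the tilt: its exponential moment contributes `2 ‖μ' - μ‖² / σ²` to the
exponent, and the squared normalisation removes half of that. -/
lemma lintegral_likelihoodRatio_sq {σ : ℝ≥0} (hσ : σ ≠ 0) (μ μ' : EuclideanSpace ℝ (Fin n)) :
    ∫⁻ y, ENNReal.ofReal (likelihoodRatio σ μ μ' y ^ 2) ∂(law σ μ)
      = ENNReal.ofReal (Real.exp (‖μ' - μ‖ ^ 2 / σ ^ 2)) := by
  have hσ' : (σ : ℝ) ≠ 0 := by exact_mod_cast hσ
  have h : ∀ y, ENNReal.ofReal (likelihoodRatio σ μ μ' y ^ 2)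
      = ENNReal.ofReal (Real.exp (-(‖μ' - μ‖ ^ 2 / σ ^ 2)))
        * ENNReal.ofReal (Real.exp ⟪y - μ, (2 * ((σ : ℝ) ^ 2)⁻¹) • (μ' - μ)⟫) := by
    intro y
    rw [← ENNReal.ofReal_mul (Real.exp_pos _).le, likelihoodRatio, ← Real.exp_nat_mul,
      ← Real.exp_add, inner_smul_right, inner_smul_right]
    congr 2
    field_simp
    push_cast
    ring
  simp_rw [h]
  rw [lintegral_const_mul _ (by fun_prop), lintegral_exp_inner_law,
    ← ENNReal.ofReal_mul (Real.exp_pos _).le, ← Real.exp_add, norm_smul]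
  congr 2
  rw [mul_pow, Real.norm_eq_abs, sq_abs]
  field_simp
  ring

/-- Change of measure with a truncated likelihood ratio. -/
lemma law_apply_le {σ : ℝ≥0} (hσ : σ ≠ 0) (μ μ' : EuclideanSpace ℝ (Fin n))
    {s : Set (EuclideanSpace ℝ (Fin n))} (hs : MeasurableSet s) {t : ℝ} (ht : 0 < t) :
    law σ μ' s ≤ ENNReal.ofReal t * law σ μ s
      + ENNReal.ofReal (t⁻¹ * Real.exp (‖μ' - μ‖ ^ 2 / σ ^ 2)) := by
  rw [law_eq_withDensity hσ μ μ', withDensity_apply _ hs]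
  -- Either `L ≤ t`, or `L ≥ t` and then `L ≤ L² / t`.
  have hpt : ∀ y, ENNReal.ofReal (likelihoodRatio σ μ μ' y)
      ≤ ENNReal.ofReal t
        + ENNReal.ofReal t⁻¹ * ENNReal.ofReal (likelihoodRatio σ μ μ' y ^ 2) := by
    intro y
    have h0 : 0 < likelihoodRatio σ μ μ' y := Real.exp_pos _
    rw [← ENNReal.ofReal_mul (by positivity), ← ENNReal.ofReal_add ht.le (by positivity)]
    refine ENNReal.ofReal_le_ofReal ?_
    rcases le_total (likelihoodRatio σ μ μ' y) t with h | h
    · exact h.trans (le_add_of_nonneg_right (by positivity))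
    · have : likelihoodRatio σ μ μ' y ≤ t⁻¹ * likelihoodRatio σ μ μ' y ^ 2 := by
        rw [inv_mul_eq_div, le_div_iff₀ ht]
        nlinarith
      linarith
  calc ∫⁻ y in s, ENNReal.ofReal (likelihoodRatio σ μ μ' y) ∂(law σ μ)
      ≤ ∫⁻ y in s, (ENNReal.ofReal t
        + ENNReal.ofReal t⁻¹ * ENNReal.ofReal (likelihoodRatio σ μ μ' y ^ 2)) ∂(law σ μ) :=
        lintegral_mono hpt
    _ = ENNReal.ofReal t * law σ μ s + ENNReal.ofReal t⁻¹ *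
        ∫⁻ y in s, ENNReal.ofReal (likelihoodRatio σ μ μ' y ^ 2) ∂(law σ μ) := by
        rw [lintegral_add_left measurable_const, setLIntegral_const, lintegral_const_mul]
        exact ((measurable_likelihoodRatio σ μ μ').pow_const 2).ennreal_ofReal
    _ ≤ _ := by
        gcongr
        rw [ENNReal.ofReal_mul (by positivity), ← lintegral_likelihoodRatio_sq hσ μ μ']
        gcongr
        exact Measure.restrict_le_self

end Gaussian

/-! ### Local packing numbers of convex sets. -/

section Packing

open Metric

lemma isSeparated_coe_iff {X : Type*} [PseudoMetricSpace X] {δ : ℝ≥0} {C : Set X} :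
    IsSeparated δ C ↔ C.Pairwise fun x y => (δ : ℝ) < dist x y := by
  simp only [IsSeparated, edist_nndist, ENNReal.coe_lt_coe, ← NNReal.coe_lt_coe, coe_nndist]

/-- Every set has a separated subset which is also a net, of the same radius. -/
lemma exists_isSeparated_isCover {X : Type*} [PseudoMetricSpace X] (δ : ℝ≥0) (K : Set X) :
    ∃ N ⊆ K, IsSeparated δ N ∧ IsCover δ K N := by
  obtain ⟨N, hN⟩ := zorn_subset {N : Set X | N ⊆ K ∧ IsSeparated δ N} (by
    intro c hc hchain
    refine ⟨⋃₀ c, ⟨Set.sUnion_subset fun s hs => (hc hs).1, ?_⟩,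
      fun s hs => Set.subset_sUnion_of_mem hs⟩
    exact (Set.pairwise_sUnion hchain.directedOn).2 fun s hs => (hc hs).2)
  exact ⟨N, hN.prop.1, hN.prop.2, IsCover.of_maximal_isSeparated hN⟩

lemma le_localEntropy_iff {n : ℕ} {c ε : ℝ≥0} {K : Set (EuclideanSpace ℝ (Fin n))} {a : ℝ} :
    (a : EReal) ≤ localEntropy c K ε ↔
      ENNReal.ofReal (Real.exp a) ≤ (localPacking c K ε : ℝ≥0∞) := by
  rw [localEntropy, ← ENNReal.log_le_log_iff, ENNReal.log_ofReal_of_pos (Real.exp_pos a),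
    Real.log_exp]

variable {n : ℕ} {c δ ε ε' : ℝ≥0} {K : Set (EuclideanSpace ℝ (Fin n))}

/-- The local packing numbers of a convex set decrease with the radius. -/
lemma localPacking_anti (hK : Convex ℝ K) (hε : 0 < ε) (h : ε ≤ ε') :
    localPacking c K ε' ≤ localPacking c K ε := by
  refine iSup₂_le fun θ hθ => iSup_le fun C => iSup_le fun hCK => iSup_le fun hC => ?_
  have hε' : (0 : ℝ) < ε' := by exact_mod_cast hε.trans_le h
  have hεr : (0 : ℝ) < ε := by exact_mod_cast hε
  -- The homothety of ratio `ε / ε'` centred at `θ` keeps `K` inside itself by convexity and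
  -- rescales packings.
  set r : ℝ := ε / ε' with hr
  have hr0 : 0 < r := by positivity
  have hr1 : r ≤ 1 := (div_le_one hε').2 (by exact_mod_cast h)
  set f : EuclideanSpace ℝ (Fin n) → EuclideanSpace ℝ (Fin n) := fun x => θ + r • (x - θ) with hf
  have hdist : ∀ x y, dist (f x) (f y) = r * dist x y := by
    intro x y
    simp only [hf, dist_add_left, dist_smul₀, dist_sub_right, Real.norm_eq_abs, abs_of_pos hr0]
  have hinj : Function.Injective f := by
    intro x y hxy
    have := hdist x y
    rw [hxy, dist_self] at this
    exact dist_eq_zero.1 ((mul_eq_zero.1 this.symm).resolve_left hr0.ne')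
  rw [← hinj.encard_image]
  refine le_trans (IsSeparated.encard_le_packingNumber ?_ ?_)
    (le_iSup₂ (f := fun θ (_ : θ ∈ K) => packingNumber (ε / c) (closedBall θ ε ∩ K)) θ hθ)
  · rintro _ ⟨x, hx, rfl⟩
    obtain ⟨hxb, hxK⟩ := hCK hx
    refine ⟨?_, hK.add_smul_sub_mem hθ hxK ⟨hr0.le, hr1⟩⟩
    have hfθ : f θ = θ := by simp [hf]
    rw [mem_closedBall] at hxb ⊢
    have hxθ := hdist x θ
    rw [hfθ] at hxθ
    rw [hxθ, hr, div_mul_eq_mul_div, div_le_iff₀ hε']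
    gcongr
  · rw [isSeparated_coe_iff] at hC ⊢
    rintro _ ⟨x, hx, rfl⟩ _ ⟨y, hy, rfl⟩ hne
    have := hC hx hy (fun h => hne (by rw [h]))
    rw [hdist, hr, div_mul_eq_mul_div, lt_div_iff₀ hε']
    rw [NNReal.coe_div] at this ⊢
    calc (ε : ℝ) / c * ε' = ε * (ε' / c) := by ring
      _ < _ := by gcongr

/-- An unbounded convex set has long segments, hence large local packing numbers at every scale. -/
lemma le_localPacking (hK : Convex ℝ K) (hub : ¬ Bornology.IsBounded K) (hc : 100 ≤ c)
    (hε : 0 < ε) : 65 ≤ localPacking c K ε := by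
  have hne : K.Nonempty := by
    by_contra h
    exact hub (by simp [Set.not_nonempty_iff_eq_empty.1 h])
  obtain ⟨θ, hθ⟩ := hne
  obtain ⟨x, hx, hxd⟩ : ∃ x ∈ K, (ε : ℝ) < dist x θ := by
    by_contra! h
    exact hub (isBounded_closedBall.subset (t := closedBall θ ε) h)
  have hεr : (0 : ℝ) < ε := by exact_mod_cast hε
  have hc' : (100 : ℝ) ≤ c := by exact_mod_cast hc
  have hD : 0 < dist x θ := hεr.trans hxd
  set r : ℝ := ε / (64 * dist x θ) with hr
  have hr0 : 0 < r := by positivity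
  -- Equally spaced points on a segment of length `ε`; the gap `ε / 64` exceeds `ε / c` because `c ≥
  -- 100`.
  set f : Fin 65 → EuclideanSpace ℝ (Fin n) := fun j => θ + ((j : ℕ) * r : ℝ) • (x - θ) with hf
  have hdist : ∀ i j, dist (f i) (f j) = |((i : ℕ) : ℝ) - (j : ℕ)| * (ε / 64) := by
    intro i j
    simp only [hf, dist_add_left]
    rw [dist_eq_norm, ← sub_smul, norm_smul, ← dist_eq_norm x θ, Real.norm_eq_abs, ← sub_mul, abs_mul,
      abs_of_pos hr0, hr]
    field_simp
  have hsep : ∀ i j, i ≠ j → (ε : ℝ) / 64 ≤ dist (f i) (f j) := by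
    intro i j hij
    rw [hdist]
    have h1 : (1 : ℝ) ≤ |((i : ℕ) : ℝ) - (j : ℕ)| := by
      have : (1 : ℤ) ≤ |((i : ℕ) : ℤ) - (j : ℕ)| :=
        Int.one_le_abs (sub_ne_zero.2 (by exact_mod_cast Fin.val_ne_of_ne hij))
      exact_mod_cast this
    exact le_mul_of_one_le_left (by positivity) h1
  have hinj : Function.Injective f := by
    intro i j hij
    by_contra h
    have := hsep i j h
    rw [hij, dist_self] at this
    linarith
  have hcard : (Set.range f).encard = 65 := by
    rw [← Set.image_univ, hinj.encard_image]
    simp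
  rw [← hcard]
  refine le_trans (IsSeparated.encard_le_packingNumber ?_ ?_)
    (le_iSup₂ (f := fun θ (_ : θ ∈ K) => packingNumber (ε / c) (closedBall θ ε ∩ K)) θ hθ)
  · rintro _ ⟨j, rfl⟩
    have hj : ((j : ℕ) : ℝ) ≤ 64 := by exact_mod_cast Nat.lt_succ_iff.1 j.2
    refine ⟨?_, hK.add_smul_sub_mem hθ hx ⟨by positivity, ?_⟩⟩
    · have h0 : f 0 = θ := by simp [hf]
      rw [mem_closedBall]
      have hjθ := hdist j 0
      rw [h0] at hjθ
      simp only [Fin.val_zero, Nat.cast_zero, sub_zero, Nat.abs_cast] at hjθ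
      rw [hjθ]
      calc ((j : ℕ) : ℝ) * (ε / 64) ≤ 64 * (ε / 64) := by gcongr
        _ = ε := by ring
    · calc ((j : ℕ) : ℝ) * r ≤ 64 * r := by gcongr
        _ = ε / dist x θ := by rw [hr]; field_simp
        _ ≤ 1 := (div_le_one hD).2 hxd.le
  · rw [isSeparated_coe_iff]
    rintro _ ⟨i, rfl⟩ _ ⟨j, rfl⟩ hne
    refine lt_of_lt_of_le ?_ (hsep i j fun h => hne (by rw [h]))
    rw [NNReal.coe_div]
    gcongr
    linarith

lemma exists_finset_of_lt_localPacking {m : ℕ} (hm : m < localPacking c K ε) :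
    ∃ θ ∈ K, ∃ C : Finset (EuclideanSpace ℝ (Fin n)), C.card = m + 1 ∧
      (∀ x ∈ C, x ∈ K ∧ dist x θ ≤ ε) ∧
      (∀ x ∈ C, ∀ y ∈ C, x ≠ y → (ε : ℝ) / c < dist x y) := by
  simp only [localPacking, packingNumber, lt_iSup_iff] at hm
  obtain ⟨θ, hθ, C, hCK, hC, hlt⟩ := hm
  obtain ⟨t, htC, ht⟩ := Set.exists_subset_encard_eq (k := ((m + 1 : ℕ) : ℕ∞))
    (by exact_mod_cast Order.add_one_le_of_lt hlt)
  have htf : t.Finite := Set.finite_of_encard_eq_coe ht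
  refine ⟨θ, hθ, htf.toFinset, ?_, fun x hx => ?_, fun x hx y hy hxy => ?_⟩
  · rw [htf.encard_eq_coe_toFinset_card] at ht
    exact_mod_cast ht
  · have := hCK (htC (htf.mem_toFinset.1 hx))
    exact ⟨this.2, this.1⟩
  · have := isSeparated_coe_iff.1 hC (htC (htf.mem_toFinset.1 hx))
      (htC (htf.mem_toFinset.1 hy)) hxy
    rwa [NNReal.coe_div] at this

/-- Iterated covering: the number of points of a separated subset in larger and larger balls. -/
lemma encard_inter_closedBall_le (hK : Convex ℝ K) (hc : 1 ≤ c) (hδ : 0 < δ) {M : ℕ}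
    (hM : localPacking c K (c * δ) ≤ M) {N : Set (EuclideanSpace ℝ (Fin n))} (hNK : N ⊆ K)
    (hN : IsSeparated δ N) (k : ℕ) :
    ∀ θ ∈ K, (N ∩ closedBall θ (c ^ (k + 1) * δ : ℝ≥0)).encard ≤ (M ^ (k + 1) : ℕ) := by
  have hc0 : c ≠ 0 := (zero_lt_one.trans_le hc).ne'
  induction k with
  | zero =>
    intro θ hθ
    rw [zero_add, pow_one, pow_one]
    refine le_trans ?_ hM
    refine le_trans (IsSeparated.encard_le_packingNumber (ε := c * δ / c) ?_ ?_)
      (le_iSup₂ (f := fun θ (_ : θ ∈ K) =>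
        packingNumber (c * δ / c) (closedBall θ ((c * δ : ℝ≥0) : ℝ) ∩ K)) θ hθ)
    · exact fun x hx => ⟨hx.2, hNK hx.1⟩
    · rw [mul_div_cancel_left₀ _ hc0]
      exact hN.subset Set.inter_subset_left
  | succ k ih =>
    intro θ hθ
    set R : ℝ≥0 := c ^ (k + 1 + 1) * δ with hR
    have hRc : R / c = c ^ (k + 1) * δ := by
      rw [hR, pow_succ]; field_simp
    -- Monotonicity carries the bound from radius `c * δ` to `R`: one factor `M` covers the ball by
    -- balls `c` times smaller, centred in `K`.
    have hp : packingNumber (R / c) (closedBall θ R ∩ K) ≤ M := by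
      refine le_trans (le_iSup₂ (f := fun θ (_ : θ ∈ K) =>
        packingNumber (R / c) (closedBall θ R ∩ K)) θ hθ) (le_trans ?_ hM)
      refine localPacking_anti hK (by positivity) ?_
      rw [hR, pow_succ, mul_comm _ c, mul_assoc]
      gcongr
      exact le_mul_of_one_le_left zero_le (one_le_pow₀ hc)
    have hp' : packingNumber (R / c) (closedBall θ R ∩ K) ≠ ⊤ :=
      (hp.trans_lt (ENat.natCast_lt_top M)).ne
    have hcov := isCover_maximalSeparatedSet hp'
    set C := maximalSeparatedSet (R / c) (closedBall θ R ∩ K)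
    have hCs : C ⊆ closedBall θ R ∩ K := maximalSeparatedSet_subset
    have hCcard : C.encard ≤ M := (encard_maximalSeparatedSet hp').trans_le hp
    have hCf : C.Finite := Set.finite_of_encard_le_coe hCcard
    have hsub : N ∩ closedBall θ R ⊆
        ⋃ x ∈ hCf.toFinset, N ∩ closedBall x (c ^ (k + 1) * δ : ℝ≥0) := by
      rintro y ⟨hyN, hyb⟩
      have := hcov.subset_iUnion_closedBall ⟨hyb, hNK hyN⟩
      simp only [Set.mem_iUnion] at this ⊢
      obtain ⟨x, hx, hyx⟩ := this
      rw [hRc] at hyx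
      exact ⟨x, hCf.mem_toFinset.2 hx, hyN, hyx⟩
    calc (N ∩ closedBall θ R).encard
        ≤ ∑ x ∈ hCf.toFinset, (N ∩ closedBall x (c ^ (k + 1) * δ : ℝ≥0)).encard :=
          (Set.encard_le_encard hsub).trans (Finset.set_encard_biUnion_le _ _)
      _ ≤ ∑ x ∈ hCf.toFinset, ((M ^ (k + 1) : ℕ) : ℕ∞) :=
          Finset.sum_le_sum fun x hx => ih x (hCs (hCf.mem_toFinset.1 hx)).2
      _ = C.encard * (M ^ (k + 1) : ℕ) := by
          rw [Finset.sum_const, hCf.encard_eq_coe_toFinset_card, nsmul_eq_mul]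
      _ ≤ M * (M ^ (k + 1) : ℕ) := by gcongr
      _ = (M ^ (k + 1 + 1) : ℕ) := by push_cast; ring

lemma isClosed_of_isSeparated {N : Set (EuclideanSpace ℝ (Fin n))} (hδ : 0 < δ)
    (hN : IsSeparated δ N) : IsClosed N :=
  isClosed_of_pairwise_le_dist (ε := (δ : ℝ)) (by exact_mod_cast hδ)
    ((isSeparated_coe_iff.1 hN).mono' fun _ _ h => h.le)

lemma countable_of_isSeparated {N : Set (EuclideanSpace ℝ (Fin n))} (hδ : 0 < δ)
    (hN : IsSeparated δ N) : N.Countable := by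
  have : DiscreteTopology N := DiscreteTopology.of_forall_le_dist (r := (δ : ℝ))
    (by exact_mod_cast hδ)
    fun x y hxy => (isSeparated_coe_iff.1 hN x.2 y.2 (fun h => hxy (Subtype.ext h))).le
  have : Countable N := countable_of_Lindelof_of_discrete
  exact N.to_countable

end Packing

/-! ### Lower bound by testing. -/

section LowerBound

open MeasureTheory Metric

variable {n : ℕ} {c σ ε : ℝ≥0} {K : Set (EuclideanSpace ℝ (Fin n))}

/-- Testing lower bound: if `Q` well separated means are close to `θ`, every estimator has a large
risk at one of them. -/
lemma exists_le_risk (hσ : σ ≠ 0) {θ : EuclideanSpace ℝ (Fin n)}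
    {C : Finset (EuclideanSpace ℝ (Fin n))} (hC64 : 64 ≤ C.card) {x r : ℝ} (hr : 0 ≤ r)
    (hCx : Real.exp (2 * x) ≤ C.card)
    (hθ : ∀ μ ∈ C, ‖μ - θ‖ ^ 2 / σ ^ 2 ≤ x)
    (hsep : ∀ μ ∈ C, ∀ μ' ∈ C, μ ≠ μ' → 2 * r ≤ dist μ μ')
    {νhat : EuclideanSpace ℝ (Fin n) → EuclideanSpace ℝ (Fin n)} (hν : Measurable νhat) :
    ∃ μ ∈ C, ENNReal.ofReal (r ^ 2 / 4) ≤ risk σ νhat μ := by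
  set A : EuclideanSpace ℝ (Fin n) → Set (EuclideanSpace ℝ (Fin n)) :=
    fun μ => {y | dist (νhat y) μ < r} with hA
  have hAm : ∀ μ, MeasurableSet (A μ) := fun μ =>
    measurableSet_lt (hν.dist measurable_const) measurable_const
  have hdisj : (C : Set (EuclideanSpace ℝ (Fin n))).PairwiseDisjoint A := by
    intro μ hμ μ' hμ' hne
    refine Set.disjoint_left.2 fun y hy hy' => ?_
    have h1 := hsep μ hμ μ' hμ' hne
    have h2 := dist_triangle_left μ μ' (νhat y)
    simp only [hA, Set.mem_ofPred_eq] at hy hy'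
    linarith
  have hCne : C.Nonempty := Finset.card_pos.1 (by omega)
  have hQ : (64 : ℝ) ≤ C.card := by exact_mod_cast hC64
  have hQ0 : (0 : ℝ) < C.card := by linarith
  -- Pigeonhole: the events `A μ` are disjoint, so one has at most average mass under the common law
  -- at `θ`.
  obtain ⟨μ, hμ, hμA⟩ : ∃ μ ∈ C, law σ θ (A μ) ≤ ENNReal.ofReal (C.card : ℝ)⁻¹ := by
    obtain ⟨μ, hμ, hmin⟩ := C.exists_min_image (fun μ => law σ θ (A μ)) hCne
    refine ⟨μ, hμ, ?_⟩
    rw [ENNReal.ofReal_inv_of_pos hQ0, ENNReal.ofReal_natCast, ENNReal.le_inv_iff_mul_le, mul_comm,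
      ← nsmul_eq_mul]
    refine (C.card_nsmul_le_sum _ _ hmin).trans ?_
    rw [← measure_biUnion_finset hdisj fun μ _ => hAm μ]
    exact prob_le_one
  refine ⟨μ, hμ, ?_⟩
  -- `exp x ≤ √Q ≤ Q / 8` as `Q = C.card ≥ 64`. Truncating at `t = Q / 4` then gives `1/4 + 1/2 =
  -- 3/4`.
  have hexp : Real.exp (‖μ - θ‖ ^ 2 / σ ^ 2) ≤ C.card / 8 := by
    refine (Real.exp_le_exp.2 (hθ μ hμ)).trans (le_of_sq_le_sq ?_ (by positivity))
    rw [← Real.exp_nat_mul]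
    push_cast
    nlinarith
  have hP : law σ μ (A μ) ≤ ENNReal.ofReal (3 / 4) := by
    refine (law_apply_le hσ θ μ (hAm μ) (t := C.card / 4) (by positivity)).trans ?_
    calc _ ≤ ENNReal.ofReal (C.card / 4) * ENNReal.ofReal (C.card : ℝ)⁻¹
          + ENNReal.ofReal ((C.card / 4 : ℝ)⁻¹ * (C.card / 8)) := by gcongr
      _ = ENNReal.ofReal (3 / 4) := by
          rw [← ENNReal.ofReal_mul (by positivity), ← ENNReal.ofReal_add (by positivity)
            (by positivity)]
          congr 1
          field_simp
          norm_num
  have hPc : ENNReal.ofReal (1 / 4) ≤ law σ μ (A μ)ᶜ := by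
    rw [prob_compl_eq_one_sub (hAm μ)]
    refine le_trans ?_ (tsub_le_tsub_left hP 1)
    rw [← ENNReal.ofReal_one, ← ENNReal.ofReal_sub _ (by norm_num)]
    norm_num
  calc ENNReal.ofReal (r ^ 2 / 4) = ENNReal.ofReal (r ^ 2) * ENNReal.ofReal (1 / 4) := by
        rw [← ENNReal.ofReal_mul (by positivity)]
        congr 1; ring
    _ ≤ ENNReal.ofReal (r ^ 2) * law σ μ (A μ)ᶜ := by gcongr
    _ = ∫⁻ _ in (A μ)ᶜ, ENNReal.ofReal (r ^ 2) ∂(law σ μ) := by rw [setLIntegral_const]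
    _ ≤ ∫⁻ y in (A μ)ᶜ, ‖νhat y - μ‖ₑ ^ 2 ∂(law σ μ) := by
        refine setLIntegral_mono' (hAm μ).compl fun y hy => ?_
        rw [ENNReal.ofReal_pow hr, ← ofReal_norm, ← dist_eq_norm]
        gcongr
        simpa [hA] using hy
    _ ≤ risk σ νhat μ := setLIntegral_le_lintegral _ _

lemma le_iSup_risk (hK : Convex ℝ K) (hub : ¬ Bornology.IsBounded K) (hc : 100 ≤ c) (hσ : 0 < σ)
    (hε : (((ε : ℝ) ^ 2 / (σ : ℝ) ^ 2 : ℝ) : EReal) ≤ localEntropy c K ε)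
    {νhat : EuclideanSpace ℝ (Fin n) → EuclideanSpace ℝ (Fin n)} (hν : Measurable νhat) :
    ((64 * c ^ 2)⁻¹ * ε ^ 2 : ℝ≥0) ≤ ⨆ μ ∈ K, risk σ νhat μ := by
  rcases eq_or_ne ε 0 with rfl | hε0
  · simp
  have hε0 : 0 < ε := pos_iff_ne_zero.2 hε0
  have hσr : (0 : ℝ) < σ := by exact_mod_cast hσ
  -- At radius `ε / 2` the available log-cardinality is `4 * x`, more than the `2 * x` that testing
  -- requires.
  set x : ℝ := ((ε / 2 : ℝ≥0) : ℝ) ^ 2 / σ ^ 2 with hx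
  have hx4 : (ε : ℝ) ^ 2 / σ ^ 2 = 4 * x := by
    rw [hx]; push_cast; ring
  have hx0 : 0 ≤ x := by positivity
  set p : ℕ := ⌈Real.exp (2 * x)⌉₊ with hp
  have hple : (p : ℕ∞) ≤ localPacking c K (ε / 2) := by
    have h1 := le_localEntropy_iff.1 hε
    have h2 : localPacking c K ε ≤ localPacking c K (ε / 2) :=
      localPacking_anti hK (by positivity) (half_le_self zero_le)
    refine le_trans ?_ h2
    cases hL : localPacking c K ε with
    | top => exact le_top
    | coe L =>
      rw [hL, ENat.toENNReal_coe, ← ENNReal.ofReal_natCast,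
        ENNReal.ofReal_le_ofReal_iff (by positivity), hx4] at h1
      have : p ≤ L := Nat.ceil_le.2 ((Real.exp_le_exp.2 (by linarith)).trans h1)
      exact_mod_cast this
  have h65 := le_localPacking hK hub hc (ε := ε / 2) (by positivity)
  -- The extracted set has one more point than this, hence at least 65 and at least `p`.
  have hm : ((max 64 (p - 1) : ℕ) : ℕ∞) < localPacking c K (ε / 2) := by
    have hp0 : 0 < p := Nat.ceil_pos.2 (Real.exp_pos _)
    rcases max_cases 64 (p - 1) with h | h
    · rw [h.1]
      exact lt_of_lt_of_le (by norm_num) h65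
    · rw [h.1]
      exact lt_of_lt_of_le (by exact_mod_cast Nat.sub_lt hp0 one_pos) hple
  obtain ⟨θ, -, C, hCcard, hCK, hCsep⟩ := exists_finset_of_lt_localPacking hm
  obtain ⟨μ, hμ, hle⟩ := exists_le_risk hσ.ne' (θ := θ) (C := C) (x := x)
    (r := (ε / 2 : ℝ≥0) / c / 2) (by omega) (by positivity)
    ((Nat.le_ceil _).trans (by exact_mod_cast (by omega : p ≤ C.card)))
    (fun μ hμ => by
      rw [hx, ← dist_eq_norm]
      have := (hCK μ hμ).2
      gcongr)
    (fun μ hμ μ' hμ' hne => by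
      rw [mul_div_cancel₀ _ two_ne_zero]
      exact (hCsep μ hμ μ' hμ' hne).le) hν
  refine le_trans ?_ (le_iSup₂_of_le (f := fun μ (_ : μ ∈ K) => risk σ νhat μ) μ (hCK μ hμ).1 hle)
  rw [← ENNReal.ofReal_coe_nnreal]
  refine ENNReal.ofReal_le_ofReal (le_of_eq ?_)
  have hc0 : (c : ℝ) ≠ 0 := by
    have : (0 : ℝ≥0) < c := lt_of_lt_of_le (by norm_num) hc
    exact_mod_cast this.ne'
  push_cast
  field_simp
  norm_num

/-- The minimax lower bound. -/
lemma epsStar_sq_le_minimaxRisk (hK : Convex ℝ K) (hub : ¬ Bornology.IsBounded K) (hc : 100 ≤ c)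
    (hσ : 0 < σ) :
    ((64 * c ^ 2)⁻¹ : ℝ≥0) * epsStar c σ K ^ 2 ≤ minimaxRisk σ K := by
  refine le_iInf₂ fun νhat hν => ?_
  -- Squaring is an order isomorphism of `[0, ∞]`, so it commutes with the supremum.
  have hsq : epsStar c σ K ^ 2 = ⨆ (ε : ℝ≥0)
      (_ : (((ε : ℝ) ^ 2 / (σ : ℝ) ^ 2 : ℝ) : EReal) ≤ localEntropy c K ε), (ε : ℝ≥0∞) ^ 2 := by
    have h2 := (ENNReal.orderIsoRpow 2 two_pos).map_iSup₂ (fun (ε : ℝ≥0)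
      (_ : (((ε : ℝ) ^ 2 / (σ : ℝ) ^ 2 : ℝ) : EReal) ≤ localEntropy c K ε) => (ε : ℝ≥0∞))
    simpa only [epsStar, ENNReal.orderIsoRpow_apply, ENNReal.rpow_two] using h2
  rw [hsq, ENNReal.mul_iSup]
  refine iSup_le fun ε => ?_
  rw [ENNReal.mul_iSup]
  refine iSup_le fun hε => ?_
  exact_mod_cast le_iSup_risk hK hub hc hσ hε hν

end LowerBound

/-! ### Upper bound by the nearest net point. -/

section UpperBound

open MeasureTheory Metric
open scoped RealInnerProductSpace

/-- A measurable nearest-point map onto a countable closed set. -/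
lemma exists_measurable_nearest {X : Type*} [PseudoMetricSpace X] [ProperSpace X]
    [MeasurableSpace X] [OpensMeasurableSpace X] {N : Set X} (hNc : IsClosed N)
    (hN : N.Countable) (hne : N.Nonempty) :
    ∃ f : X → X, Measurable f ∧ ∀ y, f y ∈ N ∧ ∀ ν ∈ N, dist y (f y) ≤ dist y ν := by
  classical
  obtain ⟨e, rfl⟩ := hN.exists_eq_range hne
  have hex : ∀ y, ∃ k, infDist y (Set.range e) = dist y (e k) := fun y => by
    obtain ⟨_, ⟨k, rfl⟩, hk⟩ := hNc.exists_infDist_eq_dist hne y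
    exact ⟨k, hk⟩
  -- Ties are broken by the least index in an enumeration, which makes the choice measurable.
  refine ⟨fun y => e (Nat.find (hex y)), ?_, fun y => ⟨⟨_, rfl⟩, fun ν hν => ?_⟩⟩
  · exact Measurable.find (f := fun k _ => e k) (fun _ => measurable_const)
      (fun k => measurableSet_eq_fun measurable_infDist (measurable_id.dist measurable_const)) hex
  · rw [← Nat.find_spec (hex y)]
    exact infDist_le_dist_of_mem hν

variable {n : ℕ} {c σ δ : ℝ≥0} {K : Set (EuclideanSpace ℝ (Fin n))}

/-- Expanding the squares around `μ` turns a wrong choice of `ν` over `μ₀` into a large linear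
functional of the noise, ready for a Chernoff bound. -/
lemma inner_ge_of_dist_le {y μ μ₀ ν : EuclideanSpace ℝ (Fin n)} (h : dist y ν ≤ dist y μ₀)
    (hμ₀ : 2 * dist μ₀ μ ≤ dist ν μ) : dist ν μ ^ 2 / 4 ≤ ⟪y - μ, ν - μ₀⟫ := by
  have h1 : ‖(y - μ) - (ν - μ)‖ ^ 2 ≤ ‖(y - μ) - (μ₀ - μ)‖ ^ 2 := by
    rw [sub_sub_sub_cancel_right, sub_sub_sub_cancel_right, ← dist_eq_norm, ← dist_eq_norm]
    gcongr
  rw [norm_sub_sq_real (y - μ), norm_sub_sq_real (y - μ), ← dist_eq_norm ν,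
    ← dist_eq_norm μ₀] at h1
  rw [← sub_sub_sub_cancel_right ν μ₀ μ, inner_sub_right]
  nlinarith [dist_nonneg (x := μ₀) (y := μ)]

/-- The contribution to the risk of a far away point `ν` of the net. -/
lemma lintegral_exp_le (hσ : 0 < σ) {μ μ₀ ν : EuclideanSpace ℝ (Fin n)}
    (hμ₀ : 2 * dist μ₀ μ ≤ dist ν μ) :
    ∫⁻ y, ENNReal.ofReal (dist ν μ ^ 2 *
        Real.exp (⟪y - μ, (16 * (σ : ℝ) ^ 2)⁻¹ • (ν - μ₀)⟫ - dist ν μ ^ 2 / (64 * σ ^ 2)))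
      ∂(law σ μ) ≤ ENNReal.ofReal (256 * σ ^ 2 * Real.exp (-(dist ν μ ^ 2 / (256 * σ ^ 2)))) := by
  have hσr : (0 : ℝ) < σ := by exact_mod_cast hσ
  set D := dist ν μ with hD
  have hD0 : 0 ≤ D := dist_nonneg
  have h1 : ∀ y : EuclideanSpace ℝ (Fin n), ENNReal.ofReal (D ^ 2 *
        Real.exp (⟪y - μ, (16 * (σ : ℝ) ^ 2)⁻¹ • (ν - μ₀)⟫ - D ^ 2 / (64 * σ ^ 2)))
      = ENNReal.ofReal (D ^ 2 * Real.exp (-(D ^ 2 / (64 * σ ^ 2)))) *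
        ENNReal.ofReal (Real.exp ⟪y - μ, (16 * (σ : ℝ) ^ 2)⁻¹ • (ν - μ₀)⟫) := by
    intro y
    rw [← ENNReal.ofReal_mul (by positivity), mul_assoc, ← Real.exp_add]
    congr 3
    ring
  simp_rw [h1]
  rw [lintegral_const_mul _ (by fun_prop), lintegral_exp_inner_law,
    ← ENNReal.ofReal_mul (by positivity), mul_assoc, ← Real.exp_add]
  refine ENNReal.ofReal_le_ofReal ?_
  have hnorm : ‖ν - μ₀‖ ≤ 2 * D := by
    rw [← dist_eq_norm]
    have := dist_triangle_right ν μ₀ μ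
    linarith
  -- The tilt `1 / (16 σ²)` is optimal for `‖ν - μ₀‖ ≤ 2D`. Of the two equal terms left, one absorbs
  -- the factor `D²` through `hu`.
  have hexp : -(D ^ 2 / (64 * σ ^ 2)) + (σ : ℝ) ^ 2 * ‖(16 * (σ : ℝ) ^ 2)⁻¹ • (ν - μ₀)‖ ^ 2 / 2
      ≤ -(D ^ 2 / (256 * σ ^ 2)) + -(D ^ 2 / (256 * σ ^ 2)) := by
    have h2 : ‖ν - μ₀‖ ^ 2 ≤ (2 * D) ^ 2 := by gcongr
    rw [norm_smul, mul_pow, Real.norm_eq_abs, sq_abs]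
    have h3 : (σ : ℝ) ^ 2 * ((16 * (σ : ℝ) ^ 2)⁻¹ ^ 2 * ‖ν - μ₀‖ ^ 2) / 2
        ≤ (σ : ℝ) ^ 2 * ((16 * (σ : ℝ) ^ 2)⁻¹ ^ 2 * (2 * D) ^ 2) / 2 := by gcongr
    have h4 : (σ : ℝ) ^ 2 * ((16 * (σ : ℝ) ^ 2)⁻¹ ^ 2 * (2 * D) ^ 2) / 2
        = 2 * (D ^ 2 / (256 * σ ^ 2)) := by field_simp; ring
    have h5 : D ^ 2 / (64 * (σ : ℝ) ^ 2) = 4 * (D ^ 2 / (256 * σ ^ 2)) := by field_simp; ring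
    linarith
  have hu : D ^ 2 ≤ 256 * σ ^ 2 * Real.exp (D ^ 2 / (256 * σ ^ 2)) := by
    have := Real.add_one_le_exp (D ^ 2 / (256 * (σ : ℝ) ^ 2))
    calc D ^ 2 = 256 * σ ^ 2 * (D ^ 2 / (256 * σ ^ 2)) := by field_simp
      _ ≤ _ := by gcongr; linarith
  calc D ^ 2 * Real.exp _ ≤ (256 * σ ^ 2 * Real.exp (D ^ 2 / (256 * σ ^ 2))) *
        Real.exp (-(D ^ 2 / (256 * σ ^ 2)) + -(D ^ 2 / (256 * σ ^ 2))) := by gcongr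
    _ = _ := by
        rw [mul_assoc, ← Real.exp_add]
        congr 2
        ring

lemma exists_shell (hc : 100 ≤ c) (hδ : 0 < δ) {D : ℝ} (hD : (c ^ 2 * δ : ℝ) < D) :
    ∃ k : ℕ, (c ^ (k + 2) * δ : ℝ) ≤ D ∧ D ≤ c ^ (k + 3) * δ := by
  have hc' : (100 : ℝ) ≤ c := by exact_mod_cast hc
  have hδ' : (0 : ℝ) < δ := by exact_mod_cast hδ
  have hpos : (0 : ℝ) < c ^ 2 * δ := by positivity
  obtain ⟨k, hk1, hk2⟩ := exists_nat_pow_near (x := D / (c ^ 2 * δ)) (y := (c : ℝ))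
    ((one_le_div hpos).2 hD.le) (by linarith)
  rw [le_div_iff₀ hpos] at hk1
  rw [div_lt_iff₀ hpos] at hk2
  exact ⟨k, by rwa [pow_add, mul_assoc], hk2.le.trans_eq (by ring)⟩

/-- Summation over shells of the net. -/
lemma tsum_net_le (hK : Convex ℝ K) (hc : 100 ≤ c) (hσ : 0 < σ) (hδ : 0 < δ)
    (hσδ : (σ : ℝ) ≤ c * δ) {M : ℕ} (hM : localPacking c K (c * δ) ≤ M)
    (hMe : (M : ℝ) ≤ Real.exp ((c * δ) ^ 2 / σ ^ 2))
    {N : Set (EuclideanSpace ℝ (Fin n))} (hNK : N ⊆ K) (hN : IsSeparated δ N)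
    {μ : EuclideanSpace ℝ (Fin n)} (hμ : μ ∈ K) :
    ∑' ν : N, (if (c ^ 2 * δ : ℝ) < dist (ν : EuclideanSpace ℝ (Fin n)) μ then
        ENNReal.ofReal (256 * σ ^ 2 * Real.exp (-(dist (ν : EuclideanSpace ℝ (Fin n)) μ ^ 2
          / (256 * σ ^ 2)))) else 0) ≤ ENNReal.ofReal (256 * σ ^ 2) := by
  classical
  have hc' : (100 : ℝ) ≤ c := by exact_mod_cast hc
  have hδ' : (0 : ℝ) < δ := by exact_mod_cast hδ
  have hσ' : (0 : ℝ) < σ := by exact_mod_cast hσ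
  set b : ℕ → ℝ≥0∞ := fun k =>
    ENNReal.ofReal (256 * σ ^ 2 * Real.exp (-((c ^ (k + 2) * δ) ^ 2 / (256 * σ ^ 2)))) with hb
  set S : ℕ → Set N := fun k => {ν | dist (ν : EuclideanSpace ℝ (Fin n)) μ ≤ c ^ (k + 3) * δ}
    with hS
  have hcard : ∀ k, (S k).encard ≤ (M ^ (k + 3) : ℕ) := by
    intro k
    refine le_trans (le_of_eq ?_) (encard_inter_closedBall_le hK (le_trans (by norm_num) hc) hδ hM
      hNK hN (k + 2) μ hμ)
    rw [← Subtype.val_injective.encard_image (S k)]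
    congr 1
    ext x
    simp [hS, and_comm]
  have hterm : ∀ k, ((M ^ (k + 3) : ℕ) : ℝ≥0∞) * b k
      ≤ ENNReal.ofReal (256 * σ ^ 2) * 2⁻¹ ^ (k + 1) := by
    intro k
    set v : ℝ := (c * δ) ^ 2 / σ ^ 2 with hv
    have hv1 : 1 ≤ v := by
      rw [hv, one_le_div (by positivity)]
      gcongr
    -- Bernoulli with `c² ≥ 10000`: the Gaussian exponent beats the entropy `(k + 3) * v` by at
    -- least `(k + 1) * v`, and `v ≥ 1`.
    have hpow : 256 * (2 * k + 4) ≤ (c : ℝ) ^ (2 * (k + 1)) := by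
      have h1 := one_add_mul_le_pow (a := (9999 : ℝ)) (by norm_num) (k + 1)
      have h2 : (1 + 9999 : ℝ) ^ (k + 1) ≤ (c : ℝ) ^ (2 * (k + 1)) := by
        rw [pow_mul]
        gcongr
        nlinarith
      push_cast at h1
      have : (0 : ℝ) ≤ k := by positivity
      linarith
    have hexp : (k + 3 : ℕ) * v + -((c ^ (k + 2) * δ) ^ 2 / (256 * σ ^ 2)) ≤ (k + 1 : ℕ) * (-1) := by
      have h1 : ((c : ℝ) ^ (k + 2) * δ) ^ 2 / (256 * σ ^ 2) = c ^ (2 * (k + 1)) / 256 * v := by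
        rw [hv]
        field_simp
        ring
      have h2 : (2 * k + 4) * v ≤ (c : ℝ) ^ (2 * (k + 1)) / 256 * v := by
        gcongr
        linarith
      rw [h1]
      push_cast
      nlinarith
    have hhalf : Real.exp (-1) ≤ 2⁻¹ := by
      rw [Real.exp_neg]
      gcongr
      have := Real.add_one_le_exp 1
      linarith
    have h2inv : (2⁻¹ : ℝ≥0∞) = ENNReal.ofReal 2⁻¹ := by
      rw [ENNReal.ofReal_inv_of_pos two_pos, ENNReal.ofReal_ofNat]
    rw [h2inv, ← ENNReal.ofReal_pow (by positivity), ← ENNReal.ofReal_natCast,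
      ← ENNReal.ofReal_mul (by positivity), ← ENNReal.ofReal_mul (by positivity)]
    refine ENNReal.ofReal_le_ofReal ?_
    push_cast
    calc (M : ℝ) ^ (k + 3) * (256 * σ ^ 2 * Real.exp (-((c ^ (k + 2) * δ) ^ 2 / (256 * σ ^ 2))))
        ≤ Real.exp v ^ (k + 3) *
          (256 * σ ^ 2 * Real.exp (-((c ^ (k + 2) * δ) ^ 2 / (256 * σ ^ 2)))) := by gcongr
      _ = 256 * σ ^ 2 * Real.exp
          ((k + 3 : ℕ) * v + -((c ^ (k + 2) * δ) ^ 2 / (256 * σ ^ 2))) := by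
          rw [Real.exp_add, Real.exp_nat_mul]; ring
      _ ≤ 256 * σ ^ 2 * Real.exp ((k + 1 : ℕ) * (-1)) := by gcongr
      _ ≤ 256 * σ ^ 2 * 2⁻¹ ^ (k + 1) := by
          rw [Real.exp_nat_mul]
          gcongr
  -- Each `S k` is a full ball rather than a shell; the overcounting is harmless for an upper bound.
  calc _ ≤ ∑' ν : N, ∑' k, (S k).indicator (fun _ => b k) ν := by
        refine ENNReal.tsum_le_tsum fun ν => ?_
        split_ifs with h
        · obtain ⟨k, hk1, hk2⟩ := exists_shell hc hδ h
          refine le_trans ?_ (ENNReal.le_tsum k)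
          rw [Set.indicator_of_mem (show ν ∈ S k from hk2)]
          refine ENNReal.ofReal_le_ofReal ?_
          gcongr
        · exact zero_le
    _ = ∑' k, ∑' ν : N, (S k).indicator (fun _ => b k) ν := ENNReal.tsum_comm
    _ = ∑' k, (S k).encard * b k := by
        refine tsum_congr fun k => ?_
        rw [← tsum_subtype, ENNReal.tsum_set_const]
    _ ≤ ∑' k, ENNReal.ofReal (256 * σ ^ 2) * 2⁻¹ ^ (k + 1) := by
        refine ENNReal.tsum_le_tsum fun k => le_trans ?_ (hterm k)
        gcongr
        exact_mod_cast ENat.toENNReal_le.2 (hcard k)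
    _ = ENNReal.ofReal (256 * σ ^ 2) := by
        rw [ENNReal.tsum_mul_left, ENNReal.tsum_geometric_add_one]
        rw [ENNReal.one_sub_inv_two, inv_inv, ENNReal.inv_mul_cancel two_ne_zero (by simp), mul_one]

/-- Risk of the nearest-point estimator on a net. -/
lemma risk_nearest_le (hK : Convex ℝ K) (hc : 100 ≤ c) (hσ : 0 < σ) (hδ : 0 < δ)
    (hσδ : (σ : ℝ) ≤ c * δ) {M : ℕ} (hM : localPacking c K (c * δ) ≤ M)
    (hMe : (M : ℝ) ≤ Real.exp ((c * δ) ^ 2 / σ ^ 2))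
    {N : Set (EuclideanSpace ℝ (Fin n))} (hNK : N ⊆ K) (hN : IsSeparated δ N)
    (hcov : IsCover δ K N) {f : EuclideanSpace ℝ (Fin n) → EuclideanSpace ℝ (Fin n)}
    (hf : ∀ y, f y ∈ N ∧ ∀ ν ∈ N, dist y (f y) ≤ dist y ν)
    {μ : EuclideanSpace ℝ (Fin n)} (hμ : μ ∈ K) :
    risk σ f μ ≤ ENNReal.ofReal ((c ^ 2 * δ) ^ 2 + 256 * σ ^ 2) := by
  classical
  have hc' : (100 : ℝ) ≤ c := by exact_mod_cast hc
  have hδ' : (0 : ℝ) < δ := by exact_mod_cast hδ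
  have hσ' : (0 : ℝ) < σ := by exact_mod_cast hσ
  have : Countable N := (countable_of_isSeparated hδ hN).to_subtype
  obtain ⟨μ₀, hμ₀N, hμ₀⟩ : ∃ μ₀ ∈ N, dist μ₀ μ ≤ δ := by
    have := hcov.subset_iUnion_closedBall hμ
    simp only [Set.mem_iUnion] at this
    obtain ⟨μ₀, h, h'⟩ := this
    exact ⟨μ₀, h, by rwa [dist_comm]⟩
  have hfar : ∀ ν : EuclideanSpace ℝ (Fin n), (c ^ 2 * δ : ℝ) < dist ν μ →
      2 * dist μ₀ μ ≤ dist ν μ := by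
    intro ν hν
    have : (2 : ℝ) * δ ≤ c ^ 2 * δ := by gcongr; nlinarith
    linarith
  set g : N → EuclideanSpace ℝ (Fin n) → ℝ≥0∞ := fun ν y =>
    if (c ^ 2 * δ : ℝ) < dist (ν : EuclideanSpace ℝ (Fin n)) μ then
      ENNReal.ofReal (dist (ν : EuclideanSpace ℝ (Fin n)) μ ^ 2 *
        Real.exp (⟪y - μ, (16 * (σ : ℝ) ^ 2)⁻¹ • ((ν : EuclideanSpace ℝ (Fin n)) - μ₀)⟫
          - dist (ν : EuclideanSpace ℝ (Fin n)) μ ^ 2 / (64 * σ ^ 2)))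
    else 0 with hg
  have hgm : ∀ ν, Measurable (g ν) := by
    intro ν
    simp only [hg]
    split_ifs
    · fun_prop
    · exact measurable_const
  -- If the selected point is far from `μ`, its own summand already dominates: the exponent there is
  -- nonnegative.
  have hpt : ∀ y, ‖f y - μ‖ₑ ^ 2 ≤ ENNReal.ofReal ((c ^ 2 * δ) ^ 2) + ∑' ν, g ν y := by
    intro y
    rw [← ofReal_norm, ← dist_eq_norm, ← ENNReal.ofReal_pow dist_nonneg]
    rcases le_or_gt (dist (f y) μ) (c ^ 2 * δ) with h | h
    · refine le_add_right (ENNReal.ofReal_le_ofReal ?_)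
      gcongr
    · refine le_add_left (le_trans ?_ (ENNReal.le_tsum ⟨f y, (hf y).1⟩))
      simp only [hg, if_pos h]
      refine ENNReal.ofReal_le_ofReal (le_mul_of_one_le_right (by positivity) ?_)
      rw [Real.one_le_exp_iff, inner_smul_right, sub_nonneg]
      have := inner_ge_of_dist_le ((hf y).2 μ₀ hμ₀N) (hfar _ h)
      calc dist (f y) μ ^ 2 / (64 * (σ : ℝ) ^ 2)
          = (16 * (σ : ℝ) ^ 2)⁻¹ * (dist (f y) μ ^ 2 / 4) := by field_simp; ring
        _ ≤ _ := by gcongr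
  calc risk σ f μ ≤ ∫⁻ y, (ENNReal.ofReal ((c ^ 2 * δ) ^ 2) + ∑' ν, g ν y) ∂(law σ μ) :=
        lintegral_mono hpt
    _ = ENNReal.ofReal ((c ^ 2 * δ) ^ 2) + ∑' ν, ∫⁻ y, g ν y ∂(law σ μ) := by
        rw [lintegral_add_left measurable_const, lintegral_const, measure_univ, mul_one,
          lintegral_tsum fun ν => (hgm ν).aemeasurable]
    _ ≤ ENNReal.ofReal ((c ^ 2 * δ) ^ 2) + ENNReal.ofReal (256 * σ ^ 2) := by
        gcongr
        refine le_trans (ENNReal.tsum_le_tsum fun ν => ?_)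
          (tsum_net_le hK hc hσ hδ hσδ hM hMe hNK hN hμ)
        simp only [hg]
        split_ifs with h
        · exact lintegral_exp_le hσ (hfar _ h)
        · simp
    _ = _ := by rw [ENNReal.ofReal_add (by positivity) (by positivity)]

/-- The radius `σ` is itself admissible, since `e ≤ 65`. -/
lemma le_epsStar (hK : Convex ℝ K) (hub : ¬ Bornology.IsBounded K) (hc : 100 ≤ c) (hσ : 0 < σ) :
    (σ : ℝ≥0∞) ≤ epsStar c σ K := by
  refine le_iSup₂ (f := fun (ε : ℝ≥0)
    (_ : (((ε : ℝ) ^ 2 / (σ : ℝ) ^ 2 : ℝ) : EReal) ≤ localEntropy c K ε) => (ε : ℝ≥0∞)) σ ?_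
  have hσ' : (σ : ℝ) ≠ 0 := by exact_mod_cast hσ.ne'
  rw [div_self (pow_ne_zero 2 hσ'), le_localEntropy_iff]
  refine le_trans ?_ (ENat.toENNReal_le.2 (le_localPacking hK hub hc hσ))
  rw [ENat.toENNReal_ofNat, ← ENNReal.ofReal_ofNat]
  refine ENNReal.ofReal_le_ofReal ?_
  have := Real.exp_one_lt_d9
  linarith

/-- The minimax upper bound. -/
lemma minimaxRisk_le_epsStar_sq (hK : Convex ℝ K) (hub : ¬ Bornology.IsBounded K) (hc : 100 ≤ c)
    (hσ : 0 < σ) :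
    minimaxRisk σ K ≤ (4 * c ^ 2 + 256 : ℝ≥0) * epsStar c σ K ^ 2 := by
  have hσε := le_epsStar hK hub hc hσ
  have hc0 : 0 < c := lt_of_lt_of_le (by norm_num) hc
  rcases eq_or_ne (epsStar c σ K) ⊤ with htop | htop
  · rw [htop, ENNReal.top_pow two_ne_zero, ENNReal.mul_top (by simp)]
    exact le_top
  obtain ⟨e, he⟩ : ∃ e : ℝ≥0, (e : ℝ≥0∞) = epsStar c σ K := ⟨_, ENNReal.coe_toNNReal htop⟩
  rw [← he] at hσε ⊢
  have hσe : σ ≤ e := by exact_mod_cast hσε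
  have he0 : 0 < e := hσ.trans_le hσe
  -- The factor 2 puts `c * δ` strictly above `ε*`, where the defining inequality must fail.
  set δ : ℝ≥0 := 2 * e / c with hδ
  have hcδ : c * δ = 2 * e := by rw [hδ]; field_simp
  have hcδ' : (c * δ : ℝ) = 2 * e := by exact_mod_cast hcδ
  have hδ0 : 0 < δ := by positivity
  have hlt : (localPacking c K (c * δ) : ℝ≥0∞)
      < ENNReal.ofReal (Real.exp ((c * δ) ^ 2 / σ ^ 2)) := by
    rw [← not_le]
    intro h
    have h' := le_localEntropy_iff.2 h
    have h2 : ((c * δ : ℝ≥0) : ℝ≥0∞) ≤ epsStar c σ K :=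
      le_iSup₂ (f := fun (ε : ℝ≥0)
        (_ : (((ε : ℝ) ^ 2 / (σ : ℝ) ^ 2 : ℝ) : EReal) ≤ localEntropy c K ε) => (ε : ℝ≥0∞))
        (c * δ) (by exact_mod_cast h')
    rw [← he, hcδ, ENNReal.coe_le_coe] at h2
    exact absurd h2 (not_le.2 (lt_mul_of_one_lt_left he0 one_lt_two))
  obtain ⟨M, hM⟩ := ENat.ne_top_iff_exists.1 (ENat.toENNReal_ne_top.1 hlt.ne_top)
  have hMe : (M : ℝ) ≤ Real.exp ((c * δ) ^ 2 / σ ^ 2) := by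
    rw [← hM, ENat.toENNReal_coe, ← ENNReal.ofReal_natCast] at hlt
    exact (ENNReal.ofReal_lt_ofReal_iff_of_nonneg (by positivity)).1 hlt |>.le
  obtain ⟨N, hNK, hN, hcov⟩ := exists_isSeparated_isCover δ K
  have hKne : K.Nonempty := by
    by_contra h
    exact hub (by simp [Set.not_nonempty_iff_eq_empty.1 h])
  obtain ⟨f, hfm, hf⟩ := exists_measurable_nearest (isClosed_of_isSeparated hδ0 hN)
    (countable_of_isSeparated hδ0 hN) (hcov.nonempty hKne)
  refine (iInf₂_le f hfm).trans (iSup₂_le fun μ hμ => ?_)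
  have hσe' : (σ : ℝ) ≤ e := by exact_mod_cast hσe
  refine (risk_nearest_le hK hc hσ hδ0 (by rw [hcδ']; linarith [e.2]) hM.ge hMe hNK hN hcov hf
    hμ).trans ?_
  have hfin : ((c : ℝ) ^ 2 * δ) ^ 2 + 256 * σ ^ 2 ≤ ((4 * c ^ 2 + 256) * e ^ 2 : ℝ≥0) := by
    have h1 : ((c : ℝ) ^ 2 * δ) ^ 2 = 4 * c ^ 2 * e ^ 2 := by
      rw [sq (c : ℝ), mul_assoc, hcδ']; ring
    have h2 : (σ : ℝ) ^ 2 ≤ e ^ 2 := by gcongr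
    push_cast
    rw [h1]
    linarith
  calc _ ≤ ENNReal.ofReal ((4 * c ^ 2 + 256) * e ^ 2 : ℝ≥0) := ENNReal.ofReal_le_ofReal hfin
    _ = _ := by rw [ENNReal.ofReal_coe_nnreal]; push_cast; rfl

end UpperBound

end GaussianSequence

theorem mainTheorem3 :
    ∃ c₀ : ℝ≥0, 0 < c₀ ∧ ∀ c : ℝ≥0, c₀ ≤ c →
      ∃ A B : ℝ≥0, 0 < A ∧ 0 < B ∧
        ∀ (n : ℕ) (K : Set (EuclideanSpace ℝ (Fin n))) (σ : ℝ≥0),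
          Convex ℝ K → ¬ Bornology.IsBounded K → 0 < σ →
            (A : ℝ≥0∞) * GaussianSequence.epsStar c σ K ^ 2 ≤ GaussianSequence.minimaxRisk σ K ∧
              GaussianSequence.minimaxRisk σ K ≤ (B : ℝ≥0∞) * GaussianSequence.epsStar c σ K ^ 2 := by
  refine ⟨100, by norm_num, fun c hc => ?_⟩
  have hc0 : 0 < c := lt_of_lt_of_le (by norm_num) hc
  exact ⟨(64 * c ^ 2)⁻¹, 4 * c ^ 2 + 256, by positivity, by positivity, fun n K σ hK hub hσ =>
    ⟨GaussianSequence.epsStar_sq_le_minimaxRisk hK hub hc hσ,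
      GaussianSequence.minimaxRisk_le_epsStar_sq hK hub hc hσ⟩⟩
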